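/- **Theorem (farthest convex set for the Hausdorff distance).** For a nonempty compact convex set $K\subset\mathbb{R}^2$ (possibly with empty interior) let $h_K(\theta)=\max\{x\cdot e^{i\theta}: x\in K\}$ be its support function, where $e^{i\theta}=(\cos\theta,\sin\theta)$; let $s(K)=\frac1\pi\int_0^{2\pi}h_K(\theta)e^{i\theta}\,d\theta$ be its Steiner point; and let $P(K)$ be its perimeter, where the perimeter of a line segment is taken as twice its length. Let $\mathcal{A}$ be the class of all such $K$ with $s(K)=O$ (the origin) and $P(K)=2\pi$, and let $d_H$ be the Hausdorff distance. Let $C\in\mathcal{A}$. Then the maximum $\max\{d_H(C,K):K\in\mathcal{A}\}$ is attained, and every set $K_C\in\mathcal{A}$ with $$d_H(C,K_C)=\max\{d_H(C,K):K\in\mathcal{A}\}$$ is a line segment. More precisely, a compact convex set $K_C$ belongs to $\mathcal{A}$ and attains this maximum if and only if $K_C$ is a segment of length $\pi$, centered at $O$ and orthogonal to the line $OQ$ for some point $Q\in C$ at which $h_C$ is maximal, that is, such that $Q\cdot e^{i\theta}=h_C(\theta)=\max h_C$ for some $\theta$. -/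

import Mathlib

open scoped ENNReal

/-- The Euclidean plane `ℝ²`. -/
abbrev Plane : Type := EuclideanSpace ℝ (Fin 2)

namespace Plane

/-- The unit vector `e^{iθ} = (cos θ, sin θ)`. -/
noncomputable def dir (θ : ℝ) : Plane := !₂[Real.cos θ, Real.sin θ]

/-- The support function `h_K(θ) = max {x · e^{iθ} : x ∈ K}` (the supremum is a maximum, as `K` is
compact and nonempty). -/
noncomputable def supportFun (K : ConvexBody Plane) (θ : ℝ) : ℝ :=
  sSup ((fun x : Plane => inner ℝ x (dir θ)) '' (K : Set Plane))

/-- `x` is a point of contact of `K` with its support line of outward unit normal `e^{iθ}`. -/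
def IsSupportPoint (K : ConvexBody Plane) (θ : ℝ) (x : Plane) : Prop :=
  x ∈ K ∧ inner ℝ x (dir θ) = supportFun K θ

/-- The Steiner point `s(K) = (1/π) ∫₀^{2π} h_K(θ) e^{iθ} dθ`. -/
noncomputable def steinerPoint (K : ConvexBody Plane) : Plane :=
  (1 / Real.pi) • ∫ θ in (0 : ℝ)..(2 * Real.pi), supportFun K θ • dir θ

/-- `x 0, x 1, …, x n = x 0` are the successive vertices of a closed polygon inscribed in the
boundary of `K` that goes around `K` exactly once, counterclockwise: the vertices lie on support
lines of `K` whose outward normal angles increase strictly and make one full turn. -/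
def IsInscribedPolygon (K : ConvexBody Plane) (n : ℕ) (x : ℕ → Plane) : Prop :=
  x n = x 0 ∧
    ∃ θ : ℕ → ℝ, θ n = θ 0 + 2 * Real.pi ∧ (∀ i < n, θ i < θ (i + 1)) ∧
      ∀ i ≤ n, IsSupportPoint K (θ i) (x i)

/-- The perimeter of `K`: the length of its boundary curve, as the supremum of the lengths of the
inscribed closed polygons. The boundary of a line segment is traversed in both directions, so that
its perimeter is twice its length. -/
noncomputable def perimeter (K : ConvexBody Plane) : ℝ≥0∞ :=
  ⨆ (n : ℕ) (x : ℕ → Plane) (_ : IsInscribedPolygon K n x),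
    ∑ i ∈ Finset.range n, edist (x i) (x (i + 1))

/-- The class `𝒜` of the compact convex sets (nonempty, possibly with empty interior) in the plane
whose Steiner point is the origin and whose perimeter is `2π`. -/
def classA : Set (ConvexBody Plane) :=
  {K | steinerPoint K = 0 ∧ perimeter K = ENNReal.ofReal (2 * Real.pi)}

/-- `K` is a set of the class `𝒜` at maximal Hausdorff distance from `C` among the sets of `𝒜`. -/
def IsFarthest (C K : ConvexBody Plane) : Prop :=
  K ∈ classA ∧ ∀ L ∈ classA,
    Metric.hausdorffDist (C : Set Plane) (L : Set Plane) ≤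
      Metric.hausdorffDist (C : Set Plane) (K : Set Plane)

/-- `Q` is a point at which `h_C` is maximal: the point of contact of `C` with a support line whose
normal angle maximizes `h_C`. -/
def IsMaxPoint (C : ConvexBody Plane) (Q : Plane) : Prop :=
  ∃ θ : ℝ, (∀ φ : ℝ, supportFun C φ ≤ supportFun C θ) ∧ IsSupportPoint C θ Q

/-- `K` is a segment centered at the origin `O`, of length `π` (hence of perimeter `2π`) and
orthogonal to the line `OQ`. -/
def IsOrthogonalNeedle (Q : Plane) (K : ConvexBody Plane) : Prop :=
  ∃ v : Plane, ‖v‖ = Real.pi / 2 ∧ inner ℝ v Q = 0 ∧ (K : Set Plane) = segment ℝ (-v) v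

end Plane

/-! The Hausdorff distance is the uniform distance of the support functions, so the problem is about
functions `h` that are sublinear, have integral 2π (Cauchy's formula) and are orthogonal to cos and
sin. Three bounds carry the proof: `h ≥ 0`, with `h θ = 0` forcing `h (θ + π) = 0`; `h ≤ π/2`, with
equality forcing zero width in the perpendicular direction; and `π/2 ≤ h θ + (h (θ + π/2) + h (θ -
π/2)) / 2` (`pi_div_two_le`).

Let `M = max h_C`. Then `h_C - h_K ≤ M` because `h_K ≥ 0`, and `h_K - h_C ≤ π/2 - h_C ≤ M` by the
second and third bounds. A needle orthogonal to a maximal point of `C` has `h_K = 0` in that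
direction, so it reaches `M`. Conversely, equality in either estimate gives a maximal direction of
`h_C` where `h_K` vanishes, and a set of the class with a zero of `h_K` is a needle.

The last two bounds come from integrating `h` against `π/2 + 2 cos`, which only sees perimeter and
Steiner point. Folded to the first quadrant, the far side of the set carries the weight `π/2 - 2
cos`, orthogonal to cos there; sublinearity makes certain quotients by cos monotone, and this
controls the sign of the far-side integral. -/

namespace Plane
open Real

/-! ### Unit vectors and polar coordinates -/

theorem inner_dir (x : Plane) (θ : ℝ) : inner ℝ x (dir θ) = x 0 * cos θ + x 1 * sin θ := by
  simp [dir, PiLp.inner_apply, Fin.sum_univ_two, mul_comm]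

theorem norm_dir (θ : ℝ) : ‖dir θ‖ = 1 := by
  simp [dir, EuclideanSpace.norm_eq, Fin.sum_univ_two]

theorem norm_sq_eq (x : Plane) : ‖x‖ ^ 2 = x 0 ^ 2 + x 1 ^ 2 := by
  simp [EuclideanSpace.norm_sq_eq, Fin.sum_univ_two]

theorem norm_dir_sub_dir_le (θ φ : ℝ) : ‖dir θ - dir φ‖ ≤ |θ - φ| := by
  apply abs_le_of_sq_le_sq' _ (abs_nonneg _) |>.2
  rw [norm_sq_eq, sq_abs]
  have h := Real.one_sub_sq_div_two_le_cos (x := θ - φ)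
  rw [cos_sub] at h
  simp only [dir, PiLp.sub_apply, Matrix.cons_val_zero, Matrix.cons_val_one]
  nlinarith [sin_sq_add_cos_sq θ, sin_sq_add_cos_sq φ]

/-- Polar coordinates in the plane. -/
theorem exists_eq_norm_smul_dir (x : Plane) : ∃ θ : ℝ, x = ‖x‖ • dir θ := by
  refine ⟨Complex.arg ⟨x 0, x 1⟩, ?_⟩
  have hn : ‖x‖ = ‖(⟨x 0, x 1⟩ : ℂ)‖ := by
    rw [← sq_eq_sq₀ (norm_nonneg _) (norm_nonneg _), norm_sq_eq, Complex.sq_norm,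
      Complex.normSq_apply]
    ring
  ext i
  rw [hn]
  fin_cases i
  · simp [dir, Complex.norm_mul_cos_arg]
  · simp [dir, Complex.norm_mul_sin_arg]

/-! ### Support functions: continuity, periodicity, sublinearity -/

section SupportFunction

variable (K : ConvexBody Plane)

theorem isCompact_image_inner_dir (θ : ℝ) :
    IsCompact ((fun x : Plane => inner ℝ x (dir θ)) '' (K : Set Plane)) :=
  K.isCompact.image (by fun_prop)

variable {K}

theorem inner_le_supportFun {x : Plane} (hx : x ∈ K) (θ : ℝ) :
    inner ℝ x (dir θ) ≤ supportFun K θ :=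
  le_csSup (isCompact_image_inner_dir K θ).bddAbove ⟨x, hx, rfl⟩

variable (K)

theorem exists_isSupportPoint (θ : ℝ) : ∃ x, IsSupportPoint K θ x := by
  obtain ⟨x, hx, h⟩ := (isCompact_image_inner_dir K θ).sSup_mem (K.nonempty.image _)
  exact ⟨x, hx, h⟩

theorem supportFun_le {θ c : ℝ} (h : ∀ x ∈ K, inner ℝ x (dir θ) ≤ c) : supportFun K θ ≤ c := by
  obtain ⟨x, hx, hxθ⟩ := exists_isSupportPoint K θ
  exact hxθ ▸ h x hx

theorem exists_norm_le : ∃ R, 0 ≤ R ∧ ∀ x ∈ K, ‖x‖ ≤ R := by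
  obtain ⟨R, hR⟩ := K.isBounded.exists_norm_le
  obtain ⟨x, hx⟩ := K.nonempty
  exact ⟨R, (norm_nonneg x).trans (hR x hx), hR⟩

variable {K} in
theorem abs_inner_sub_inner_le {R : ℝ} {x : Plane} (hx : ‖x‖ ≤ R) (θ φ : ℝ) :
    |inner ℝ x (dir θ) - inner ℝ x (dir φ)| ≤ R * |θ - φ| := by
  rw [← inner_sub_right]
  exact (abs_real_inner_le_norm _ _).trans
    (mul_le_mul hx (norm_dir_sub_dir_le θ φ) (norm_nonneg _) ((norm_nonneg _).trans hx))

theorem supportFun_sub_le {R : ℝ} (hR : ∀ x ∈ K, ‖x‖ ≤ R) (θ φ : ℝ) :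
    supportFun K θ - supportFun K φ ≤ R * |θ - φ| := by
  obtain ⟨x, hx, hxθ⟩ := exists_isSupportPoint K θ
  have h₁ := (abs_le.1 (abs_inner_sub_inner_le (hR x hx) θ φ)).2
  have h₂ := inner_le_supportFun hx φ
  linarith

theorem continuous_supportFun : Continuous (supportFun K) := by
  obtain ⟨R, hR₀, hR⟩ := exists_norm_le K
  refine (LipschitzWith.of_dist_le_mul (K := R.toNNReal) fun θ φ => ?_).continuous
  rw [Real.dist_eq, Real.dist_eq, abs_le, Real.coe_toNNReal R hR₀]
  have h₁ := supportFun_sub_le K hR θ φ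
  have h₂ := supportFun_sub_le K hR φ θ
  rw [abs_sub_comm] at h₂
  exact ⟨by linarith, h₁⟩

theorem dir_add_two_pi (θ : ℝ) : dir (θ + 2 * π) = dir θ := by simp [dir]

theorem periodic_supportFun : Function.Periodic (supportFun K) (2 * π) := fun θ => by
  simp only [supportFun, dir_add_two_pi]

/-- Sublinearity of the support function of a convex set in the plane. -/
theorem supportFun_le_add {θ φ ψ a b : ℝ} (ha : 0 ≤ a) (hb : 0 ≤ b)
    (hcos : cos θ = a * cos φ + b * cos ψ) (hsin : sin θ = a * sin φ + b * sin ψ) :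
    supportFun K θ ≤ a * supportFun K φ + b * supportFun K ψ := by
  refine supportFun_le K fun x hx => ?_
  have h₁ := mul_le_mul_of_nonneg_left (inner_le_supportFun hx φ) ha
  have h₂ := mul_le_mul_of_nonneg_left (inner_le_supportFun hx ψ) hb
  rw [inner_dir] at *
  rw [hcos, hsin]
  linarith

end SupportFunction

theorem continuous_dir : Continuous dir := by
  unfold dir
  refine (PiLp.continuous_toLp 2 _).comp (continuous_pi fun i => ?_)
  fin_cases i
  · exact continuous_cos
  · exact continuous_sin

/-! ### The Steiner point and the normalization -/

theorem steinerPoint_apply (K : ConvexBody Plane) :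
    steinerPoint K 0 = 1 / π * ∫ θ in (0 : ℝ)..2 * π, supportFun K θ * cos θ ∧
      steinerPoint K 1 = 1 / π * ∫ θ in (0 : ℝ)..2 * π, supportFun K θ * sin θ := by
  have hI : IntervalIntegrable (fun θ => supportFun K θ • dir θ) MeasureTheory.volume 0 (2 * π) :=
    ((continuous_supportFun K).smul continuous_dir).intervalIntegrable _ _
  have key (i : Fin 2) : steinerPoint K i
      = 1 / π * ∫ θ in (0 : ℝ)..2 * π, (supportFun K θ • dir θ) i := by
    have := (EuclideanSpace.proj i : Plane →L[ℝ] ℝ).intervalIntegral_comp_comm hI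
    simp only [PiLp.proj_apply] at this
    rw [this, steinerPoint, PiLp.smul_apply, smul_eq_mul]
  exact ⟨by simpa [dir] using key 0, by simpa [dir] using key 1⟩

theorem steinerPoint_eq_zero_iff (K : ConvexBody Plane) :
    steinerPoint K = 0 ↔ (∫ θ in (0 : ℝ)..2 * π, supportFun K θ * cos θ) = 0 ∧
      (∫ θ in (0 : ℝ)..2 * π, supportFun K θ * sin θ) = 0 := by
  obtain ⟨h₀, h₁⟩ := steinerPoint_apply K
  have hpi : (1 / π : ℝ) ≠ 0 := by positivity
  constructor
  · intro h
    rw [h] at h₀ h₁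
    exact ⟨by simpa [hpi, pi_ne_zero] using h₀.symm, by simpa [hpi, pi_ne_zero] using h₁.symm⟩
  · rintro ⟨hc, hs⟩
    ext i
    fin_cases i
    · simpa [hc] using h₀
    · simpa [hs] using h₁

/-- The support functions of compact convex sets of perimeter `2π` with Steiner point `O`,
described by the properties used below. -/
structure IsNormalizedSupport (h : ℝ → ℝ) : Prop where
  continuous : Continuous h
  periodic : Function.Periodic h (2 * π)
  le_add : ∀ {θ φ ψ a b : ℝ}, 0 ≤ a → 0 ≤ b → cos θ = a * cos φ + b * cos ψ →
    sin θ = a * sin φ + b * sin ψ → h θ ≤ a * h φ + b * h ψ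
  integral : ∫ θ in (0 : ℝ)..2 * π, h θ = 2 * π
  integral_cos : ∫ θ in (0 : ℝ)..2 * π, h θ * cos θ = 0
  integral_sin : ∫ θ in (0 : ℝ)..2 * π, h θ * sin θ = 0

/-! ### Integrals on the first quadrant -/

/-- The integral over a period, folded to a quarter of the period. -/
theorem integral_period_eq_quarter {f : ℝ → ℝ} (hf : Continuous f)
    (hp : Function.Periodic f (2 * π)) :
    ∫ t in (0 : ℝ)..2 * π, f t
      = ∫ t in (0 : ℝ)..π / 2, (f t + f (-t) + (f (π - t) + f (π + t))) := by
  have hi (g : ℝ → ℝ) (hg : Continuous g) (a b : ℝ) :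
      IntervalIntegrable g MeasureTheory.volume a b := hg.intervalIntegrable a b
  have h₀ : ∫ t in (0 : ℝ)..2 * π, f t = ∫ t in (-(π / 2))..(-(π / 2) + 2 * π), f t := by
    simpa using hp.intervalIntegral_add_eq 0 (-(π / 2))
  have h₁ : ∫ t in (0 : ℝ)..π / 2, f (-t) = ∫ t in (-(π / 2))..0, f t := by
    rw [intervalIntegral.integral_comp_neg, neg_zero]
  have h₂ : ∫ t in (0 : ℝ)..π / 2, f (π - t) = ∫ t in (π / 2)..π, f t := by
    rw [intervalIntegral.integral_comp_sub_left]
    congr 1 <;> ring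
  have h₃ : ∫ t in (0 : ℝ)..π / 2, f (π + t) = ∫ t in π..(-(π / 2) + 2 * π), f t := by
    rw [intervalIntegral.integral_comp_add_left]
    congr 1 <;> ring
  rw [intervalIntegral.integral_add (hi _ (by fun_prop) _ _) (hi _ (by fun_prop) _ _),
    intervalIntegral.integral_add (hi _ (by fun_prop) _ _) (hi _ (by fun_prop) _ _),
    intervalIntegral.integral_add (hi _ (by fun_prop) _ _) (hi _ (by fun_prop) _ _), h₀, h₁, h₂, h₃,
    ← intervalIntegral.integral_add_adjacent_intervals (hi f hf (-(π / 2)) 0) (hi f hf 0 _),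
    ← intervalIntegral.integral_add_adjacent_intervals (hi f hf 0 (π / 2)) (hi f hf (π / 2) _),
    ← intervalIntegral.integral_add_adjacent_intervals (hi f hf (π / 2) π) (hi f hf π _)]
  ring

theorem integral_cos_quarter : ∫ t in (0 : ℝ)..π / 2, cos t = 1 := by simp

theorem integral_sin_quarter : ∫ t in (0 : ℝ)..π / 2, sin t = 1 := by simp

theorem integral_cos_sq_quarter : ∫ t in (0 : ℝ)..π / 2, cos t ^ 2 = π / 4 := by
  rw [integral_cos_sq]; simp; ring

theorem integral_cos_mul_sin_quarter : ∫ t in (0 : ℝ)..π / 2, cos t * sin t = 1 / 2 := by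
  have := integral_sin_mul_cos₁ (a := 0) (b := π / 2)
  simp only [mul_comm (cos _)]
  rw [this]; simp

/-- A function whose quotient by `cos` is nondecreasing on the first quadrant has nonnegative
integral against `π / 2 - 2 cos`. -/
theorem integral_mul_nonneg_of_div_cos_mono {D : ℝ → ℝ} (hD : Continuous D)
    (hmono : ∀ r s, 0 ≤ r → r ≤ s → s ≤ π / 2 → D r * cos s ≤ D s * cos r) :
    0 ≤ ∫ t in (0 : ℝ)..π / 2, D t * (π / 2 - 2 * cos t) := by
  have hπ := pi_pos
  have hπ4 : π / 4 ≤ 1 := by linarith [pi_le_four]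
  -- The zero of the weight `π/2 - 2 cos`, which is negative before `r` and positive after it.
  set r := arccos (π / 4) with hr
  have hcr : cos r = π / 4 := cos_arccos (by linarith) hπ4
  have hr₀ : 0 ≤ r := arccos_nonneg _
  have hr₁ : r ≤ π / 2 := arccos_le_pi_div_two.2 (by positivity)
  -- The weight is orthogonal to cos, so a multiple of cos may be subtracted from `D`. The multiple
  -- that makes the difference vanish at `r` gives it the sign of the weight everywhere.
  have hzero : ∫ t in (0 : ℝ)..π / 2, D r / (π / 4) * (π / 2 * cos t - 2 * cos t ^ 2) = 0 := by
    rw [intervalIntegral.integral_const_mul, intervalIntegral.integral_sub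
      (Continuous.intervalIntegrable (by fun_prop) _ _)
      (Continuous.intervalIntegrable (by fun_prop) _ _), intervalIntegral.integral_const_mul,
      intervalIntegral.integral_const_mul, integral_cos_quarter, integral_cos_sq_quarter]
    ring
  refine hzero.symm.trans_le ?_
  refine intervalIntegral.integral_mono_on (by positivity)
    (Continuous.intervalIntegrable (by fun_prop) _ _)
    (Continuous.intervalIntegrable (by fun_prop) _ _) fun t ht => ?_
  have key : 0 ≤ (D t * (π / 4) - D r * cos t) * (π / 2 - 2 * cos t) := by
    rcases le_total t r with h | h
    · have h₁ := hmono t r ht.1 h hr₁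
      have h₂ := cos_le_cos_of_nonneg_of_le_pi ht.1 (by linarith) h
      rw [hcr] at h₁ h₂
      exact mul_nonneg_of_nonpos_of_nonpos (by linarith) (by linarith)
    · have h₁ := hmono r t hr₀ h ht.2
      have h₂ := cos_le_cos_of_nonneg_of_le_pi hr₀ (by linarith [ht.2]) h
      rw [hcr] at h₁ h₂
      exact mul_nonneg (by linarith) (by linarith)
  have e : D t * (π / 2 - 2 * cos t) - D r / (π / 4) * (π / 2 * cos t - 2 * cos t ^ 2)
      = (D t * (π / 4) - D r * cos t) * (π / 2 - 2 * cos t) / (π / 4) := by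
    field_simp
  have := div_nonneg key (by positivity : 0 ≤ π / 4)
  linarith

/-! ### Sharp bounds for normalized support functions -/

namespace IsNormalizedSupport

variable {h : ℝ → ℝ} (H : IsNormalizedSupport h)

include H

/-- Rotation invariance: each bound need only be proved in the direction 0. -/
theorem comp_add (α : ℝ) : IsNormalizedSupport (fun t => h (α + t)) := by
  have hc := H.continuous
  have shift (f : ℝ → ℝ) (hf : Function.Periodic f (2 * π)) :
      ∫ t in (0 : ℝ)..2 * π, f (α + t) = ∫ t in (0 : ℝ)..2 * π, f t := by
    rw [intervalIntegral.integral_comp_add_left, add_zero]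
    simpa using hf.intervalIntegral_add_eq α 0
  have hC := shift (fun t => h t * cos t) fun t => by simp [H.periodic t]
  have hS := shift (fun t => h t * sin t) fun t => by simp [H.periodic t]
  simp only [H.integral_cos, H.integral_sin] at hC hS
  refine ⟨by fun_prop, fun t => ?_, fun ha hb h₁ h₂ => H.le_add ha hb ?_ ?_, ?_, ?_, ?_⟩
  · rw [← add_assoc, H.periodic]
  · rw [cos_add, cos_add, cos_add, h₁, h₂]; ring
  · rw [sin_add, sin_add, sin_add, h₁, h₂]; ring
  · rw [shift h H.periodic, H.integral]
  · have e (t : ℝ) : h (α + t) * cos t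
        = cos α * (h (α + t) * cos (α + t)) + sin α * (h (α + t) * sin (α + t)) := by
      rw [cos_add, sin_add]
      linear_combination (-(h (α + t) * cos t)) * sin_sq_add_cos_sq α
    simp only [e]
    rw [intervalIntegral.integral_add (Continuous.intervalIntegrable (by fun_prop) _ _)
      (Continuous.intervalIntegrable (by fun_prop) _ _), intervalIntegral.integral_const_mul,
      intervalIntegral.integral_const_mul, hC, hS]
    simp
  · have e (t : ℝ) : h (α + t) * sin t
        = cos α * (h (α + t) * sin (α + t)) - sin α * (h (α + t) * cos (α + t)) := by
      rw [cos_add, sin_add]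
      linear_combination (-(h (α + t) * sin t)) * sin_sq_add_cos_sq α
    simp only [e]
    rw [intervalIntegral.integral_sub (Continuous.intervalIntegrable (by fun_prop) _ _)
      (Continuous.intervalIntegrable (by fun_prop) _ _), intervalIntegral.integral_const_mul,
      intervalIntegral.integral_const_mul, hC, hS]
    simp

theorem integral_cos_quarter : ∫ t in (0 : ℝ)..π / 2,
    cos t * (h t + h (-t) - (h (π - t) + h (π + t))) = 0 := by
  have hc := H.continuous
  refine Eq.trans ?_ H.integral_cos
  rw [integral_period_eq_quarter (f := fun t => h t * cos t) (by fun_prop)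
    (fun t => by simp [H.periodic t])]
  refine intervalIntegral.integral_congr fun t _ => ?_
  simp only [cos_neg, cos_pi_sub, cos_add, cos_pi, sin_pi]
  ring

/-- The constraints fix the integral of `h` against any combination of 1 and cos. The ratio `π/2 :
2` is the one for which the far-side weight `π/2 - 2 cos` is orthogonal to cos on the quadrant. -/
theorem integral_weight_quarter : ∫ t in (0 : ℝ)..π / 2,
    ((h t + h (-t)) * (π / 2 + 2 * cos t) + (h (π - t) + h (π + t)) * (π / 2 - 2 * cos t))
      = π ^ 2 := by
  have hc := H.continuous
  have h₁ : ∫ t in (0 : ℝ)..2 * π, (π / 2 * h t + 2 * (h t * cos t)) = π ^ 2 := by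
    rw [intervalIntegral.integral_add (Continuous.intervalIntegrable (by fun_prop) _ _)
      (Continuous.intervalIntegrable (by fun_prop) _ _), intervalIntegral.integral_const_mul,
      intervalIntegral.integral_const_mul, H.integral, H.integral_cos]
    ring
  rw [← h₁, integral_period_eq_quarter (by fun_prop) (fun t => by simp [H.periodic t])]
  refine intervalIntegral.integral_congr fun t _ => ?_
  simp only [cos_neg, cos_pi_sub, cos_add, cos_pi, sin_pi]
  ring

/-- Sublinearity along `e^{it} = e^{i(π-t)} + 2 cos t · e^{i0}` and its mirror image. -/
theorem reflect_le {t : ℝ} (h0 : 0 ≤ t) (h1 : t ≤ π / 2) :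
    h t + h (-t) - (h (π - t) + h (π + t)) ≤ 4 * cos t * h 0 := by
  have hcos : 0 ≤ 2 * cos t := by
    have := cos_nonneg_of_neg_pi_div_two_le_of_le (by linarith [pi_pos]) h1
    linarith
  have h₁ := H.le_add (θ := t) (φ := π - t) (ψ := 0) zero_le_one hcos
    (by rw [cos_pi_sub, cos_zero]; ring) (by rw [sin_pi_sub, sin_zero]; ring)
  have h₂ := H.le_add (θ := -t) (φ := π + t) (ψ := 0) zero_le_one hcos
    (by simp [cos_add]; ring) (by simp [sin_add])
  linarith

/-- Integrating the slack of `reflect_le` against cos leaves only `h 0`, since the Steiner condition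
removes the other terms. The sign of `h 0`, and the case `h 0 = 0`, follow from this identity. -/
theorem integral_reflect : ∫ t in (0 : ℝ)..π / 2,
    cos t * (4 * cos t * h 0 - (h t + h (-t) - (h (π - t) + h (π + t)))) = π * h 0 := by
  have hc := H.continuous
  have e (t : ℝ) : cos t * (4 * cos t * h 0 - (h t + h (-t) - (h (π - t) + h (π + t))))
      = 4 * h 0 * cos t ^ 2 - cos t * (h t + h (-t) - (h (π - t) + h (π + t))) := by ring
  simp only [e]
  rw [intervalIntegral.integral_sub (Continuous.intervalIntegrable (by fun_prop) _ _)
    (Continuous.intervalIntegrable (by fun_prop) _ _), intervalIntegral.integral_const_mul,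
    integral_cos_sq_quarter, H.integral_cos_quarter]
  ring

/-- The Steiner point of a convex set belongs to it. -/
theorem nonneg_zero : 0 ≤ h 0 := by
  have : 0 ≤ π * h 0 := by
    rw [← H.integral_reflect]
    refine intervalIntegral.integral_nonneg (by positivity) fun t ht => mul_nonneg
      (cos_nonneg_of_neg_pi_div_two_le_of_le (by linarith [pi_pos, ht.1]) ht.2) ?_
    linarith [H.reflect_le ht.1 ht.2]
  exact nonneg_of_mul_nonneg_right this pi_pos

theorem eq_zero_pi_of_eq_zero (h0 : h 0 = 0) : h π = 0 := by
  have hc := H.continuous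
  by_contra hne
  have hpos : 0 < h π := lt_of_le_of_ne
    (by simpa using (H.comp_add π).nonneg_zero) (Ne.symm hne)
  have hlt : h 0 + h (-0) - (h (π - 0) + h (π + 0)) < 0 := by
    simp only [neg_zero, sub_zero, add_zero]; linarith
  -- At `t = 0` the nonnegative integrand equals `2 (h 0 + h π)`, which is positive here although
  -- the integral is `π * h 0 = 0`.
  have := intervalIntegral.integral_pos (a := 0) (b := π / 2)
    (f := fun t => cos t * (4 * cos t * h 0 - (h t + h (-t) - (h (π - t) + h (π + t)))))
    (by positivity) (by fun_prop)
    (fun t ht => mul_nonneg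
      (cos_nonneg_of_neg_pi_div_two_le_of_le (by linarith [pi_pos, ht.1]) ht.2)
      (by linarith [H.reflect_le ht.1.le ht.2]))
    ⟨0, ⟨le_rfl, by positivity⟩, by simp [h0]; linarith⟩
  rw [H.integral_reflect, h0, mul_zero] at this
  exact lt_irrefl _ this

/-- For `t < π/2` this is sublinearity along `e^{i0} = (e^{it} + e^{-it}) / (2 cos t)`; at `t = π/2`
it reduces to nonnegativity. -/
theorem two_mul_cos_le {t : ℝ} (h0 : 0 ≤ t) (h1 : t ≤ π / 2) :
    2 * cos t * h 0 ≤ h t + h (-t) := by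
  have hcos := cos_nonneg_of_neg_pi_div_two_le_of_le (by linarith [pi_pos]) h1
  rcases hcos.eq_or_lt with hz | hp
  · have ht : t = π / 2 := by
      by_contra hne
      exact (cos_pos_of_mem_Ioo ⟨by linarith [pi_pos], lt_of_le_of_ne h1 hne⟩).ne hz
    have h₁ := (H.comp_add t).nonneg_zero
    have h₂ := (H.comp_add (-t)).nonneg_zero
    simp only [add_zero] at h₁ h₂
    rw [← hz]; linarith
  · have hi : 0 ≤ 1 / (2 * cos t) := by positivity
    have h₁ := H.le_add (θ := 0) (φ := t) (ψ := -t) hi hi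
      (by simp; field_simp; norm_num) (by simp)
    rw [← mul_add] at h₁
    calc 2 * cos t * h 0 ≤ 2 * cos t * (1 / (2 * cos t) * (h t + h (-t))) := by gcongr
      _ = h t + h (-t) := by field_simp

/-- For `r ≤ s` the vectors `e^{i(π∓r)}` are nonnegative combinations of `e^{i(π∓s)}`, with
coefficients `sin (s ± r) / sin (2s)` whose sum is `cos r / cos s`. -/
theorem fold_div_cos_mono {r s : ℝ} (hr : 0 ≤ r) (hrs : r ≤ s) (hs : s ≤ π / 2) :
    (h (π - r) + h (π + r)) * cos s ≤ (h (π - s) + h (π + s)) * cos r := by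
  have hπ := pi_pos
  have hcr := cos_nonneg_of_neg_pi_div_two_le_of_le (by linarith) (hrs.trans hs)
  -- The case `r = 0` is separate because `s` may then be 0, where the denominator `sin (2s)`
  -- vanishes.
  rcases hr.eq_or_lt with rfl | hr'
  · have := (H.comp_add π).two_mul_cos_le hrs hs
    simp only [add_zero, ← sub_eq_add_neg] at this
    simp only [sub_zero, add_zero, cos_zero]
    linarith
  have hss : 0 < sin s := sin_pos_of_pos_of_lt_pi (by linarith) (by linarith)
  have hcs := cos_nonneg_of_neg_pi_div_two_le_of_le (by linarith) hs
  have ha : 0 ≤ sin (s + r) := sin_nonneg_of_nonneg_of_le_pi (by linarith) (by linarith)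
  have hb : 0 ≤ sin (s - r) := sin_nonneg_of_nonneg_of_le_pi (by linarith) (by linarith)
  rcases hcs.eq_or_lt with hz | hp
  · rw [← hz, mul_zero]
    have h₁ := (H.comp_add (π - s)).nonneg_zero
    have h₂ := (H.comp_add (π + s)).nonneg_zero
    simp only [add_zero] at h₁ h₂
    positivity
  · have hden : 0 < 2 * sin s * cos s := by positivity
    have ha' : 0 ≤ sin (s + r) / (2 * sin s * cos s) := by positivity
    have hb' : 0 ≤ sin (s - r) / (2 * sin s * cos s) := by positivity
    have h₁ := H.le_add (θ := π - r) (φ := π - s) (ψ := π + s) ha' hb'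
      (by simp only [cos_pi_sub, cos_add, cos_pi, sin_pi, sin_add, sin_sub]; field_simp; ring)
      (by simp only [cos_pi, sin_pi, sin_add, sin_sub]; field_simp; ring)
    have h₂ := H.le_add (θ := π + r) (φ := π + s) (ψ := π - s) ha' hb'
      (by simp only [cos_pi_sub, cos_add, cos_pi, sin_pi, sin_add, sin_sub]; field_simp; ring)
      (by simp only [cos_pi, sin_pi, sin_add, sin_sub]; field_simp; ring)
    calc (h (π - r) + h (π + r)) * cos s
        ≤ ((sin (s + r) / (2 * sin s * cos s) + sin (s - r) / (2 * sin s * cos s))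
            * (h (π - s) + h (π + s))) * cos s := by gcongr; linarith
      _ = (h (π - s) + h (π + s)) * cos r := by
        rw [sin_add, sin_sub]; field_simp; ring

theorem integral_fold_nonneg :
    0 ≤ ∫ t in (0 : ℝ)..π / 2, (h (π - t) + h (π + t)) * (π / 2 - 2 * cos t) := by
  have hc := H.continuous
  exact integral_mul_nonneg_of_div_cos_mono (D := fun t => h (π - t) + h (π + t)) (by fun_prop)
    fun r s hr hrs hs => H.fold_div_cos_mono hr hrs hs

/-- The far side contributes a nonnegative amount to the total `π ^ 2`, and the part `2 cos t * h 0`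
of the near side integrates to `2 * π * h 0`. As the excess is nonnegative, this yields `h 0 ≤ π /
2` and forces zero excess in the equality case. -/
theorem integral_excess_le : ∫ t in (0 : ℝ)..π / 2,
    (h t + h (-t) - 2 * cos t * h 0) * (π / 2 + 2 * cos t) ≤ π ^ 2 - 2 * π * h 0 := by
  have hc := H.continuous
  have h₁ := H.integral_weight_quarter
  rw [intervalIntegral.integral_add (Continuous.intervalIntegrable (by fun_prop) _ _)
    (Continuous.intervalIntegrable (by fun_prop) _ _)] at h₁
  have h₂ := H.integral_fold_nonneg
  have e (t : ℝ) : (h t + h (-t) - 2 * cos t * h 0) * (π / 2 + 2 * cos t)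
      = (h t + h (-t)) * (π / 2 + 2 * cos t) - (π * h 0 * cos t + 4 * h 0 * cos t ^ 2) := by ring
  simp only [e]
  rw [intervalIntegral.integral_sub (Continuous.intervalIntegrable (by fun_prop) _ _)
    (Continuous.intervalIntegrable (by fun_prop) _ _),
    intervalIntegral.integral_add (Continuous.intervalIntegrable (by fun_prop) _ _)
    (Continuous.intervalIntegrable (by fun_prop) _ _), intervalIntegral.integral_const_mul,
    intervalIntegral.integral_const_mul, Plane.integral_cos_quarter, integral_cos_sq_quarter]
  linarith

theorem excess_nonneg {t : ℝ} (h0 : 0 ≤ t) (h1 : t ≤ π / 2) :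
    0 ≤ (h t + h (-t) - 2 * cos t * h 0) * (π / 2 + 2 * cos t) := by
  have := cos_nonneg_of_neg_pi_div_two_le_of_le (by linarith [pi_pos]) h1
  have := H.two_mul_cos_le h0 h1
  exact mul_nonneg (by linarith) (by positivity)

theorem le_pi_div_two_zero : h 0 ≤ π / 2 := by
  have h₁ : 0 ≤ π ^ 2 - 2 * π * h 0 := le_trans
    (intervalIntegral.integral_nonneg (by positivity) fun t ht => H.excess_nonneg ht.1 ht.2)
    H.integral_excess_le
  nlinarith [pi_pos]

theorem width_eq_zero_of_eq_pi_div_two (h0 : h 0 = π / 2) : h (π / 2) + h (-(π / 2)) = 0 := by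
  have hc := H.continuous
  have hn := H.two_mul_cos_le (t := π / 2) (by positivity) le_rfl
  rw [cos_pi_div_two] at hn
  by_contra hne
  have hpos : 0 < h (π / 2) + h (-(π / 2)) := lt_of_le_of_ne (by linarith) (Ne.symm hne)
  -- At `t = π/2` the excess is the perpendicular width itself, so a positive width would make the
  -- integral positive.
  have h₁ := intervalIntegral.integral_pos (a := 0) (b := π / 2)
    (f := fun t => (h t + h (-t) - 2 * cos t * h 0) * (π / 2 + 2 * cos t))
    (by positivity) (by fun_prop) (fun t ht => H.excess_nonneg ht.1.le ht.2)
    ⟨π / 2, ⟨by positivity, le_rfl⟩, by rw [cos_pi_div_two]; simp; positivity⟩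
  have h₂ := H.integral_excess_le
  rw [h0] at h₁ h₂
  linarith

theorem le_cos_add_sin {t : ℝ} (h0 : 0 ≤ t) (h1 : t ≤ π / 2) :
    h t ≤ cos t * h 0 + sin t * h (π / 2) ∧ h (-t) ≤ cos t * h 0 + sin t * h (-(π / 2)) := by
  have hcos := cos_nonneg_of_neg_pi_div_two_le_of_le (by linarith [pi_pos]) h1
  have hsin := sin_nonneg_of_nonneg_of_le_pi h0 (by linarith [pi_pos])
  exact ⟨H.le_add hcos hsin (by simp) (by simp), H.le_add hcos hsin (by simp) (by simp)⟩

/-- Sublinearity along `e^{i(π-s)} = (cos s / cos r) e^{i(π-r)} + (sin (s-r) / cos r) e^{iπ/2}` and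
its mirror image. This gives the same monotonicity with reversed sign for the far side, after
comparison with a sine. -/
theorem sine_defect_div_cos_mono {r s : ℝ} (hr : 0 ≤ r) (hrs : r ≤ s) (hs : s ≤ π / 2) :
    ((h (π / 2) + h (-(π / 2))) * sin r - (h (π - r) + h (π + r))) * cos s
      ≤ ((h (π / 2) + h (-(π / 2))) * sin s - (h (π - s) + h (π + s))) * cos r := by
  have hπ := pi_pos
  have hcs := cos_nonneg_of_neg_pi_div_two_le_of_le (by linarith) hs
  rcases (hrs.trans hs).eq_or_lt with h2 | h2
  · have : s = r := by linarith
    rw [this]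
  have hcr := cos_pos_of_mem_Ioo ⟨by linarith, h2⟩
  have hsn : 0 ≤ sin (s - r) := sin_nonneg_of_nonneg_of_le_pi (by linarith) (by linarith)
  have ha : 0 ≤ cos s / cos r := by positivity
  have hb : 0 ≤ sin (s - r) / cos r := by positivity
  have h₁ := H.le_add (θ := π - s) (φ := π - r) (ψ := π / 2) ha hb
    (by simp only [cos_pi_sub, cos_pi_div_two]; field_simp; ring)
    (by
      rw [sin_pi_sub, sin_pi_sub, sin_pi_div_two, sin_sub]; field_simp; ring)
  have h₂ := H.le_add (θ := π + s) (φ := π + r) (ψ := -(π / 2)) ha hb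
    (by simp only [cos_add, cos_pi, sin_pi, cos_neg, cos_pi_div_two]; field_simp; ring)
    (by
      simp only [sin_add, cos_pi, sin_pi, sin_neg, sin_pi_div_two, sin_sub]; field_simp; ring)
  have h₃ := mul_le_mul_of_nonneg_right (add_le_add h₁ h₂) hcr.le
  have e : (cos s / cos r * h (π - r) + sin (s - r) / cos r * h (π / 2)
      + (cos s / cos r * h (π + r) + sin (s - r) / cos r * h (-(π / 2)))) * cos r
      = cos s * (h (π - r) + h (π + r)) + sin (s - r) * (h (π / 2) + h (-(π / 2))) := by
    field_simp; ring
  rw [e, sin_sub] at h₃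
  linarith

theorem integral_fold_le :
    ∫ t in (0 : ℝ)..π / 2, (h (π - t) + h (π + t)) * (π / 2 - 2 * cos t)
      ≤ (π / 2 - 1) * (h (π / 2) + h (-(π / 2))) := by
  have hc := H.continuous
  have h₁ := integral_mul_nonneg_of_div_cos_mono
    (D := fun t => (h (π / 2) + h (-(π / 2))) * sin t - (h (π - t) + h (π + t))) (by fun_prop)
    fun r s hr hrs hs => H.sine_defect_div_cos_mono hr hrs hs
  set m := h (π / 2) + h (-(π / 2))
  have e (t : ℝ) : (m * sin t - (h (π - t) + h (π + t))) * (π / 2 - 2 * cos t)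
      = (π / 2 * m * sin t - 2 * m * (cos t * sin t))
        - (h (π - t) + h (π + t)) * (π / 2 - 2 * cos t) := by ring
  simp only [e] at h₁
  rw [intervalIntegral.integral_sub (Continuous.intervalIntegrable (by fun_prop) _ _)
    (Continuous.intervalIntegrable (by fun_prop) _ _),
    intervalIntegral.integral_sub (Continuous.intervalIntegrable (by fun_prop) _ _)
    (Continuous.intervalIntegrable (by fun_prop) _ _), intervalIntegral.integral_const_mul,
    intervalIntegral.integral_const_mul, integral_sin_quarter, integral_cos_mul_sin_quarter] at h₁
  linarith

/-- With `m` the perpendicular width, the near side contributes at most `2π h 0 + (π/2 + 1) m` and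
the far side at most `(π/2 - 1) m`; the total is `π ^ 2`. -/
theorem pi_div_two_le_zero : π / 2 ≤ h 0 + (h (π / 2) + h (-(π / 2))) / 2 := by
  have hc := H.continuous
  have h₁ := H.integral_weight_quarter
  rw [intervalIntegral.integral_add (Continuous.intervalIntegrable (by fun_prop) _ _)
    (Continuous.intervalIntegrable (by fun_prop) _ _)] at h₁
  have h₂ := H.integral_fold_le
  set m := h (π / 2) + h (-(π / 2)) with hm
  have h₃ : ∫ t in (0 : ℝ)..π / 2, (h t + h (-t)) * (π / 2 + 2 * cos t)
      ≤ ∫ t in (0 : ℝ)..π / 2, ((π * h 0 * cos t + 4 * h 0 * cos t ^ 2)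
        + (π / 2 * m * sin t + 2 * m * (cos t * sin t))) := by
    refine intervalIntegral.integral_mono_on (by positivity)
      (Continuous.intervalIntegrable (by fun_prop) _ _)
      (Continuous.intervalIntegrable (by fun_prop) _ _) fun t ht => ?_
    have hcos := cos_nonneg_of_neg_pi_div_two_le_of_le (by linarith [pi_pos, ht.1]) ht.2
    obtain ⟨ha, hb⟩ := H.le_cos_add_sin ht.1 ht.2
    have := mul_le_mul_of_nonneg_right (add_le_add ha hb)
      (by positivity : 0 ≤ π / 2 + 2 * cos t)
    refine this.trans (le_of_eq ?_)
    rw [hm]; ring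
  rw [intervalIntegral.integral_add (Continuous.intervalIntegrable (by fun_prop) _ _)
    (Continuous.intervalIntegrable (by fun_prop) _ _),
    intervalIntegral.integral_add (Continuous.intervalIntegrable (by fun_prop) _ _)
    (Continuous.intervalIntegrable (by fun_prop) _ _),
    intervalIntegral.integral_add (Continuous.intervalIntegrable (by fun_prop) _ _)
    (Continuous.intervalIntegrable (by fun_prop) _ _), intervalIntegral.integral_const_mul,
    intervalIntegral.integral_const_mul, intervalIntegral.integral_const_mul,
    intervalIntegral.integral_const_mul, integral_sin_quarter, integral_cos_mul_sin_quarter,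
    Plane.integral_cos_quarter, integral_cos_sq_quarter] at h₃
  nlinarith [pi_pos]

theorem nonneg (θ : ℝ) : 0 ≤ h θ := by simpa using (H.comp_add θ).nonneg_zero

theorem eq_zero_add_pi {θ : ℝ} (hθ : h θ = 0) : h (θ + π) = 0 :=
  (H.comp_add θ).eq_zero_pi_of_eq_zero (by simpa using hθ)

theorem le_pi_div_two (θ : ℝ) : h θ ≤ π / 2 := by
  simpa using (H.comp_add θ).le_pi_div_two_zero

theorem eq_zero_of_eq_pi_div_two {θ : ℝ} (hθ : h θ = π / 2) : h (θ + π / 2) = 0 := by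
  have h₁ := (H.comp_add θ).width_eq_zero_of_eq_pi_div_two (by simpa using hθ)
  have h₂ := H.nonneg (θ + π / 2)
  have h₃ := H.nonneg (θ + -(π / 2))
  linarith

theorem pi_div_two_le (θ : ℝ) : π / 2 ≤ h θ + (h (θ + π / 2) + h (θ - π / 2)) / 2 := by
  simpa [sub_eq_add_neg] using (H.comp_add θ).pi_div_two_le_zero

end IsNormalizedSupport

/-! ### Cauchy's formula for the perimeter -/

theorem integral_inner_dir (x : Plane) (a b : ℝ) :
    ∫ t in a..b, inner ℝ x (dir t)
      = inner ℝ x (dir (a + π / 2)) - inner ℝ x (dir (b + π / 2)) := by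
  simp only [inner_dir, cos_add_pi_div_two, sin_add_pi_div_two]
  rw [intervalIntegral.integral_add (Continuous.intervalIntegrable (by fun_prop) _ _)
    (Continuous.intervalIntegrable (by fun_prop) _ _), intervalIntegral.integral_const_mul,
    intervalIntegral.integral_const_mul, integral_cos, integral_sin]
  ring

theorem continuous_inner_dir (x : Plane) : Continuous fun t => inner ℝ x (dir t) :=
  continuous_const.inner continuous_dir

theorem inner_dir_dir (a b : ℝ) : inner ℝ (dir a) (dir b) = cos (a - b) := by
  rw [inner_dir, cos_sub]; simp [dir]

/-- The chord between two points of contact is a nonnegative multiple of a tangent direction whose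
angle lies between those of the two support lines. -/
theorem exists_sub_eq_norm_smul_dir {K : ConvexBody Plane} {a b : ℝ} {x y : Plane} (hab : a < b)
    (hx : IsSupportPoint K a x) (hy : IsSupportPoint K b y) :
    ∃ φ, a ≤ φ ∧ φ ≤ b ∧ y - x = ‖y - x‖ • dir (φ + π / 2) := by
  have hπ := pi_pos
  rcases eq_or_ne y x with rfl | hne
  · exact ⟨a, le_rfl, hab.le, by simp⟩
  have hpos : 0 < ‖y - x‖ := norm_pos_iff.2 (sub_ne_zero.2 hne)
  obtain ⟨α, hα⟩ := exists_eq_norm_smul_dir (y - x)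
  set φ := toIcoMod two_pi_pos a (α - π / 2) with hφ
  have hφm := toIcoMod_mem_Ico two_pi_pos a (α - π / 2)
  rw [← hφ] at hφm
  have hdir : dir (φ + π / 2) = dir α := by
    have hp : Function.Periodic dir (2 * π) := dir_add_two_pi
    rw [hφ, toIcoMod]
    have e : α - π / 2 - toIcoDiv two_pi_pos a (α - π / 2) • (2 * π) + π / 2
        = α - toIcoDiv two_pi_pos a (α - π / 2) • (2 * π) := by ring
    rw [e, hp.sub_zsmul_eq]
  rw [← hdir] at hα
  have hina : inner ℝ (y - x) (dir a) ≤ 0 := by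
    rw [inner_sub_left, hx.2]; linarith [inner_le_supportFun hy.1 a]
  have hinb : 0 ≤ inner ℝ (y - x) (dir b) := by
    rw [inner_sub_left, hy.2]; linarith [inner_le_supportFun hx.1 b]
  rw [hα, real_inner_smul_left, inner_dir_dir] at hina hinb
  have hca := nonpos_of_mul_nonpos_right hina hpos
  have hcb := nonneg_of_mul_nonneg_right hinb hpos
  rw [show φ + π / 2 - a = φ - a + π / 2 by ring, cos_add_pi_div_two] at hca
  rw [show φ + π / 2 - b = φ - b + π / 2 by ring, cos_add_pi_div_two] at hcb
  -- The contact conditions say `sin (φ - a) ≥ 0` and `sin (φ - b) ≤ 0`. With `φ` in `[a, a + 2π)`,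
  -- the first places it in `[a, a + π]`, and the second then excludes `φ > b`.
  have h₁ : φ - a ≤ π := by
    by_contra! hlt
    have : sin (φ - a - 2 * π) < 0 := sin_neg_of_neg_of_neg_pi_lt (by linarith [hφm.2])
      (by linarith)
    rw [sin_sub_two_pi] at this
    linarith
  refine ⟨φ, hφm.1, ?_, hα⟩
  by_contra! hlt
  have : 0 < sin (φ - b) := sin_pos_of_pos_of_lt_pi (by linarith) (by linarith)
  linarith

/-- The support function dominates that of `x` up to the normal angle `φ` of the chord and that of
`y` after it. Integrating these sinusoids produces the chord length and boundary terms that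
telescope around a closed polygon. -/
theorem dist_le_integral {K : ConvexBody Plane} {a b : ℝ} {x y : Plane} (hab : a < b)
    (hx : IsSupportPoint K a x) (hy : IsSupportPoint K b y) :
    dist x y ≤ (∫ t in a..b, supportFun K t)
      + (inner ℝ y (dir (b + π / 2)) - inner ℝ x (dir (a + π / 2))) := by
  obtain ⟨φ, haφ, hφb, hφ⟩ := exists_sub_eq_norm_smul_dir hab hx hy
  have hc := continuous_supportFun K
  have h₁ : ∫ t in a..φ, inner ℝ x (dir t) ≤ ∫ t in a..φ, supportFun K t :=
    intervalIntegral.integral_mono_on haφ ((continuous_inner_dir x).intervalIntegrable _ _)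
      (hc.intervalIntegrable _ _) fun t _ => inner_le_supportFun hx.1 t
  have h₂ : ∫ t in φ..b, inner ℝ y (dir t) ≤ ∫ t in φ..b, supportFun K t :=
    intervalIntegral.integral_mono_on hφb ((continuous_inner_dir y).intervalIntegrable _ _)
      (hc.intervalIntegrable _ _) fun t _ => inner_le_supportFun hy.1 t
  rw [integral_inner_dir] at h₁ h₂
  have h₃ : dist x y = inner ℝ (y - x) (dir (φ + π / 2)) := by
    rw [dist_eq_norm', hφ, real_inner_smul_left, real_inner_self_eq_norm_sq, norm_dir, norm_smul,
      norm_dir]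
    simp
  rw [h₃, inner_sub_left, ← intervalIntegral.integral_add_adjacent_intervals
    (hc.intervalIntegrable a φ) (hc.intervalIntegrable φ b)]
  linarith

/-- On `[a, b]` the support function exceeds that of the single point `y` by at most `2R(b - a)`.
The error is quadratic in the step, so it vanishes in the limit of fine subdivisions. -/
theorem integral_le_dist {K : ConvexBody Plane} {R : ℝ} (hR : ∀ x ∈ K, ‖x‖ ≤ R) {a b : ℝ}
    {x y : Plane} (hab : a ≤ b) (hy : IsSupportPoint K b y) :
    (∫ t in a..b, supportFun K t)
      + (inner ℝ y (dir (b + π / 2)) - inner ℝ x (dir (a + π / 2))) - 2 * R * (b - a) ^ 2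
      ≤ dist x y := by
  have hR₀ : 0 ≤ R := (norm_nonneg _).trans (hR y hy.1)
  have hc := continuous_supportFun K
  have h₁ : ∫ t in a..b, supportFun K t
      ≤ ∫ t in a..b, (inner ℝ y (dir t) + 2 * R * (b - a)) := by
    refine intervalIntegral.integral_mono_on hab (hc.intervalIntegrable _ _)
      (((continuous_inner_dir y).add continuous_const).intervalIntegrable _ _) fun t ht => ?_
    have e₁ := supportFun_sub_le K hR t b
    have e₂ := (abs_le.1 (abs_inner_sub_inner_le (hR y hy.1) b t)).2
    rw [abs_sub_comm] at e₁
    rw [hy.2] at e₂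
    have e₃ : R * |b - t| ≤ R * (b - a) := by
      rw [abs_of_nonneg (by linarith [ht.2])]
      exact mul_le_mul_of_nonneg_left (by linarith [ht.1]) hR₀
    linarith
  rw [intervalIntegral.integral_add ((continuous_inner_dir y).intervalIntegrable _ _)
    (continuous_const.intervalIntegrable _ _), integral_inner_dir,
    intervalIntegral.integral_const, smul_eq_mul] at h₁
  have h₂ : inner ℝ (y - x) (dir (a + π / 2)) ≤ dist x y := by
    rw [dist_eq_norm']
    simpa [norm_dir] using real_inner_le_norm (y - x) (dir (a + π / 2))
  rw [inner_sub_left] at h₂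
  linarith

theorem integral_supportFun_period (K : ConvexBody Plane) (a : ℝ) :
    ∫ t in a..a + 2 * π, supportFun K t = ∫ t in (0 : ℝ)..2 * π, supportFun K t := by
  simpa using (periodic_supportFun K).intervalIntegral_add_eq a 0

theorem sum_integral_add_eq (K : ConvexBody Plane) (n : ℕ) (θ : ℕ → ℝ) (x : ℕ → Plane)
    (hx : x n = x 0) (hθ : θ n = θ 0 + 2 * π) :
    ∑ i ∈ Finset.range n, ((∫ t in θ i..θ (i + 1), supportFun K t)
      + (inner ℝ (x (i + 1)) (dir (θ (i + 1) + π / 2)) - inner ℝ (x i) (dir (θ i + π / 2))))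
      = ∫ t in (0 : ℝ)..2 * π, supportFun K t := by
  rw [Finset.sum_add_distrib, intervalIntegral.sum_integral_adjacent_intervals
    (fun k _ => (continuous_supportFun K).intervalIntegrable _ _),
    Finset.sum_range_sub (fun i => (inner ℝ (x i) (dir (θ i + π / 2)) : ℝ)), hx, hθ,
    integral_supportFun_period, add_right_comm, dir_add_two_pi]
  ring

theorem sum_edist_eq (n : ℕ) (x : ℕ → Plane) :
    ∑ i ∈ Finset.range n, edist (x i) (x (i + 1))
      = ENNReal.ofReal (∑ i ∈ Finset.range n, dist (x i) (x (i + 1))) := by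
  rw [ENNReal.ofReal_sum_of_nonneg fun _ _ => dist_nonneg]
  simp only [edist_dist]

theorem perimeter_le (K : ConvexBody Plane) :
    perimeter K ≤ ENNReal.ofReal (∫ t in (0 : ℝ)..2 * π, supportFun K t) := by
  refine iSup_le fun n => iSup_le fun x => iSup_le fun ⟨hx, θ, hθ, hlt, hs⟩ => ?_
  rw [sum_edist_eq, ← sum_integral_add_eq K n θ x hx hθ]
  refine ENNReal.ofReal_le_ofReal (Finset.sum_le_sum fun i hi => ?_)
  have hi := Finset.mem_range.1 hi
  exact dist_le_integral (hlt i hi) (hs i hi.le) (hs (i + 1) hi)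

theorem le_perimeter_of_pos {K : ConvexBody Plane} {R : ℝ} (hR : ∀ x ∈ K, ‖x‖ ≤ R) (m : ℕ) :
    ENNReal.ofReal ((∫ t in (0 : ℝ)..2 * π, supportFun K t)
      - 2 * R * (2 * π) ^ 2 * (1 / ((m : ℝ) + 1))) ≤ perimeter K := by
  choose s hs using exists_isSupportPoint K
  set n := m + 1 with hn
  have hnpos : (0 : ℝ) < n := by positivity
  set θ : ℕ → ℝ := fun i => 2 * π / n * i with hθ
  -- The angles 0 and 2π could be assigned different contact points, so the last vertex is set to
  -- the first to close the polygon.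
  set x : ℕ → Plane := fun i => if i = n then s 0 else s (θ i) with hx
  have hx0 : x n = x 0 := by simp [hx, hθ, hn]
  have hθn : θ n = θ 0 + 2 * π := by simp only [hθ]; field_simp; simp
  have hstep (i : ℕ) : θ (i + 1) - θ i = 2 * π / n := by simp only [hθ]; push_cast; ring
  have hsup (i : ℕ) : IsSupportPoint K (θ i) (x i) := by
    by_cases h : i = n
    · have e : θ i = 0 + 2 * π := by rw [h, hθn]; simp [hθ]
      have h0 := hs 0
      simp only [hx, h, if_true]
      rw [← h, e]
      exact ⟨h0.1, by rw [dir_add_two_pi, periodic_supportFun K 0, h0.2]⟩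
    · simp only [hx, h, if_false]
      exact hs _
  have hpoly : IsInscribedPolygon K n x := ⟨hx0, θ, hθn, fun i _ => by
    have := hstep i
    have : 0 < 2 * π / n := by positivity
    linarith, fun i _ => hsup i⟩
  refine le_trans ?_ (le_iSup_of_le n (le_iSup_of_le x (le_iSup_of_le hpoly le_rfl)))
  rw [sum_edist_eq, ← sum_integral_add_eq K n θ x hx0 hθn]
  refine ENNReal.ofReal_le_ofReal ?_
  have e : 2 * R * (2 * π) ^ 2 * (1 / ((m : ℝ) + 1))
      = ∑ i ∈ Finset.range n, 2 * R * (θ (i + 1) - θ i) ^ 2 := by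
    simp only [hstep, Finset.sum_const, Finset.card_range, nsmul_eq_mul]
    rw [hn]; push_cast; field_simp
  rw [e, ← Finset.sum_sub_distrib]
  refine Finset.sum_le_sum fun i _ => integral_le_dist hR ?_ (hsup (i + 1))
  have := hstep i
  have : 0 < 2 * π / n := by positivity
  linarith

/-- Cauchy's formula: the perimeter is the integral of the support function. -/
theorem perimeter_eq (K : ConvexBody Plane) :
    perimeter K = ENNReal.ofReal (∫ t in (0 : ℝ)..2 * π, supportFun K t) := by
  obtain ⟨R, -, hR⟩ := exists_norm_le K
  refine le_antisymm (perimeter_le K) (le_of_tendsto' (x := Filter.atTop)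
    (ENNReal.tendsto_ofReal ?_) (le_perimeter_of_pos hR))
  simpa using (tendsto_one_div_add_atTop_nhds_zero_nat (𝕜 := ℝ)).const_mul
    (2 * R * (2 * π) ^ 2) |>.const_sub (∫ t in (0 : ℝ)..2 * π, supportFun K t)

theorem mem_classA_iff (K : ConvexBody Plane) :
    K ∈ classA ↔ IsNormalizedSupport (supportFun K) := by
  rw [classA, Set.mem_ofPred_eq, steinerPoint_eq_zero_iff, perimeter_eq]
  constructor
  · rintro ⟨⟨hc, hs⟩, hp⟩
    refine ⟨continuous_supportFun K, periodic_supportFun K, supportFun_le_add K, ?_, hc, hs⟩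
    have h := congrArg ENNReal.toReal hp
    rw [ENNReal.toReal_ofReal two_pi_pos.le] at h
    -- `ENNReal.ofReal` sends negative reals to 0, so a nonpositive integral must be excluded.
    rcases le_total (∫ t in (0 : ℝ)..2 * π, supportFun K t) 0 with h0 | h0
    · rw [ENNReal.ofReal_of_nonpos h0] at h
      simp at h
    · rwa [ENNReal.toReal_ofReal h0] at h
  · intro H
    exact ⟨⟨H.integral_cos, H.integral_sin⟩, by rw [H.integral]⟩

/-! ### Needles -/

theorem inner_dir_add_pi (x : Plane) (θ : ℝ) : inner ℝ x (dir (θ + π)) = -inner ℝ x (dir θ) := by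
  simp only [inner_dir, cos_add_pi, sin_add_pi]; ring

theorem inner_dir_sub_pi_div_two (x : Plane) (θ : ℝ) :
    inner ℝ x (dir (θ - π / 2)) = -inner ℝ x (dir (θ + π / 2)) := by
  simp only [inner_dir, cos_sub_pi_div_two, sin_sub_pi_div_two, cos_add_pi_div_two,
    sin_add_pi_div_two]
  ring

theorem eq_inner_smul_dir (x : Plane) (θ : ℝ) :
    x = (inner ℝ x (dir θ) : ℝ) • dir θ
      + (inner ℝ x (dir (θ + π / 2)) : ℝ) • dir (θ + π / 2) := by
  have h := sin_sq_add_cos_sq θ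
  rw [inner_dir, inner_dir]
  ext i
  fin_cases i
  · simp [cos_add_pi_div_two, sin_add_pi_div_two, dir]
    linear_combination -(x 0) * h
  · simp [cos_add_pi_div_two, sin_add_pi_div_two, dir]
    linear_combination -(x 1) * h

/-- A set of the class `𝒜` with `O` on its boundary is a needle. -/
theorem eq_segment_of_supportFun_eq_zero {K : ConvexBody Plane} (hK : K ∈ classA) {θ : ℝ}
    (hθ : supportFun K θ = 0) :
    (K : Set Plane) = segment ℝ (-((π / 2) • dir (θ + π / 2))) ((π / 2) • dir (θ + π / 2)) := by
  have H := (mem_classA_iff K).1 hK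
  have hθ' := H.eq_zero_add_pi hθ
  have hx {x : Plane} (hx : x ∈ K) :
      x = (inner ℝ x (dir (θ + π / 2)) : ℝ) • dir (θ + π / 2) := by
    have h₁ := inner_le_supportFun hx θ
    have h₂ := inner_le_supportFun hx (θ + π)
    rw [inner_dir_add_pi] at h₂
    have h₃ : inner ℝ x (dir θ) = 0 := by linarith
    conv_lhs => rw [eq_inner_smul_dir x θ, h₃, zero_smul, zero_add]
  -- Both supports along the line are at most `π/2`, and since `h θ = 0` their sum is at least `π`;
  -- hence both equal `π/2`.
  have hb := H.le_pi_div_two (θ + π / 2)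
  have ha := H.le_pi_div_two (θ - π / 2)
  have hab := H.pi_div_two_le θ
  obtain ⟨y, hy, hyθ⟩ := exists_isSupportPoint K (θ + π / 2)
  obtain ⟨z, hz, hzθ⟩ := exists_isSupportPoint K (θ - π / 2)
  apply Set.Subset.antisymm
  · intro x hxK
    have h₁ := inner_le_supportFun hxK (θ + π / 2)
    have h₂ := inner_le_supportFun hxK (θ - π / 2)
    rw [inner_dir_sub_pi_div_two] at h₂
    have e := hx hxK
    set c : ℝ := inner ℝ x (dir (θ + π / 2))
    refine ⟨1 / 2 - c / π, 1 / 2 + c / π, ?_, ?_, by ring, ?_⟩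
    · rw [sub_nonneg, div_le_div_iff₀ pi_pos two_pos]; linarith
    · have : -(1 / 2) ≤ c / π := by rw [le_div_iff₀ pi_pos]; linarith
      linarith
    · rw [e, smul_neg, ← neg_smul, smul_smul, smul_smul, ← add_smul]
      congr 1
      field_simp
      ring
  · refine K.convex.segment_subset ?_ ?_
    · have e := hx hz
      rw [inner_dir_sub_pi_div_two] at hzθ
      rw [show (inner ℝ z (dir (θ + π / 2)) : ℝ) = -(π / 2) by linarith, neg_smul] at e
      rwa [← e]
    · have e := hx hy
      rw [show (inner ℝ y (dir (θ + π / 2)) : ℝ) = π / 2 by linarith] at e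
      rwa [← e]

theorem supportFun_of_eq_segment {K : ConvexBody Plane} {v : Plane}
    (hK : (K : Set Plane) = segment ℝ (-v) v) (θ : ℝ) :
    supportFun K θ = |inner ℝ v (dir θ)| := by
  have hmem (x : Plane) : x ∈ K ↔ x ∈ segment ℝ (-v) v := by rw [← hK]; rfl
  apply le_antisymm
  · refine supportFun_le K fun x hx => ?_
    obtain ⟨a, b, ha, hb, hab, rfl⟩ := (hmem x).1 hx
    rw [inner_add_left, real_inner_smul_left, real_inner_smul_left, inner_neg_left]
    have h₁ := mul_le_mul_of_nonneg_left (neg_le_abs (inner ℝ v (dir θ) : ℝ)) ha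
    have h₂ := mul_le_mul_of_nonneg_left (le_abs_self (inner ℝ v (dir θ) : ℝ)) hb
    have h₃ : a * |(inner ℝ v (dir θ) : ℝ)| + b * |(inner ℝ v (dir θ) : ℝ)|
        = |(inner ℝ v (dir θ) : ℝ)| := by rw [← add_mul, hab, one_mul]
    linarith
  · refine abs_le'.2 ⟨inner_le_supportFun ((hmem v).2 (right_mem_segment ℝ _ _)) θ, ?_⟩
    rw [← inner_neg_left]
    exact inner_le_supportFun ((hmem (-v)).2 (left_mem_segment ℝ _ _)) θ

theorem integral_eq_zero_of_antiperiodic {f : ℝ → ℝ} (hf : Continuous f)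
    (hp : Function.Antiperiodic f π) : ∫ t in (0 : ℝ)..2 * π, f t = 0 := by
  have h : ∫ t in (0 : ℝ)..π, f (t + π) = ∫ t in π..2 * π, f t := by
    rw [intervalIntegral.integral_comp_add_right]
    congr 1 <;> ring
  rw [← intervalIntegral.integral_add_adjacent_intervals (hf.intervalIntegrable 0 π)
    (hf.intervalIntegrable π (2 * π)), ← h]
  simp only [hp _, intervalIntegral.integral_neg, add_neg_cancel]

theorem integral_abs_cos : ∫ t in (0 : ℝ)..2 * π, |cos t| = 4 := by
  rw [integral_period_eq_quarter (f := fun t => |cos t|) (by fun_prop)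
    (fun t => by simp)]
  have e : ∀ t ∈ Set.uIcc (0 : ℝ) (π / 2),
      |cos t| + |cos (-t)| + (|cos (π - t)| + |cos (π + t)|) = 4 * cos t := fun t ht => by
    rw [Set.uIcc_of_le (by positivity)] at ht
    have := cos_nonneg_of_neg_pi_div_two_le_of_le (by linarith [pi_pos, ht.1]) ht.2
    rw [cos_neg, cos_pi_sub, add_comm π, cos_add_pi, abs_neg, abs_of_nonneg this]
    ring
  rw [intervalIntegral.integral_congr e, intervalIntegral.integral_const_mul,
    integral_cos_quarter, mul_one]

/-- A centered segment of length `π` belongs to the class `𝒜`. -/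
theorem mem_classA_of_eq_segment {K : ConvexBody Plane} {v : Plane} (hv : ‖v‖ = π / 2)
    (hK : (K : Set Plane) = segment ℝ (-v) v) : K ∈ classA := by
  obtain ⟨α, hα⟩ := exists_eq_norm_smul_dir v
  have hs (t : ℝ) : supportFun K t = |inner ℝ v (dir t)| := supportFun_of_eq_segment hK t
  have hc := continuous_supportFun K
  -- Central symmetry makes `h` π-periodic, so its products with cos and sin are antiperiodic and
  -- integrate to 0.
  have hp : Function.Periodic (supportFun K) π := fun t => by
    rw [hs, hs, inner_dir_add_pi, abs_neg]
  refine (mem_classA_iff K).2 ⟨hc, periodic_supportFun K, supportFun_le_add K, ?_,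
    integral_eq_zero_of_antiperiodic (by fun_prop) fun t => by simp [hp t],
    integral_eq_zero_of_antiperiodic (by fun_prop) fun t => by simp [hp t]⟩
  have e (t : ℝ) : supportFun K (α + t) = π / 2 * |cos t| := by
    rw [hs, hα, hv, real_inner_smul_left, inner_dir_dir, abs_mul, abs_of_pos (by positivity),
      show α - (α + t) = -t by ring, cos_neg]
  have h₁ : ∫ t in (0 : ℝ)..2 * π, supportFun K (α + t)
      = ∫ t in (0 : ℝ)..2 * π, supportFun K t := by
    rw [intervalIntegral.integral_comp_add_left, add_zero]
    exact integral_supportFun_period K α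
  rw [← h₁]
  simp only [e]
  rw [intervalIntegral.integral_const_mul, integral_abs_cos]
  ring

/-! ### Hausdorff distance through support functions -/

theorem exists_forall_le_of_periodic {f : ℝ → ℝ} (hf : Continuous f)
    (hp : Function.Periodic f (2 * π)) : ∃ θ, ∀ φ, f φ ≤ f θ := by
  obtain ⟨θ, -, hθ⟩ := isCompact_Icc.exists_isMaxOn
    (Set.nonempty_Icc.2 two_pi_pos.le) hf.continuousOn
  refine ⟨θ, fun φ => ?_⟩
  obtain ⟨ψ, hψ, e⟩ := hp.exists_mem_Ico₀ two_pi_pos φ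
  rw [e]
  exact hθ (Set.Ico_subset_Icc_self hψ)

theorem supportFun_sub_le_hausdorffDist (C K : ConvexBody Plane) (θ : ℝ) :
    supportFun C θ - supportFun K θ ≤ Metric.hausdorffDist (C : Set Plane) (K : Set Plane) := by
  obtain ⟨x, hx, hxθ⟩ := exists_isSupportPoint C θ
  obtain ⟨y, hy, hxy⟩ := K.isCompact.exists_infDist_eq_dist K.nonempty x
  have h₁ := Metric.infDist_le_hausdorffDist_of_mem (s := (C : Set Plane)) (t := (K : Set Plane))
    hx ConvexBody.hausdorffEDist_ne_top
  have h₂ := inner_le_supportFun (K := K) hy θ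
  have h₃ : inner ℝ (x - y) (dir θ) ≤ dist x y := by
    rw [dist_eq_norm]
    simpa [norm_dir] using real_inner_le_norm (x - y) (dir θ)
  rw [inner_sub_left, hxθ] at h₃
  linarith

theorem abs_supportFun_sub_le_hausdorffDist (C K : ConvexBody Plane) (θ : ℝ) :
    |supportFun C θ - supportFun K θ|
      ≤ Metric.hausdorffDist (C : Set Plane) (K : Set Plane) := by
  refine abs_le'.2 ⟨supportFun_sub_le_hausdorffDist C K θ, ?_⟩
  rw [neg_sub, Metric.hausdorffDist_comm]
  exact supportFun_sub_le_hausdorffDist K C θ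

/-- If `x` is outside `K` and `y` is its nearest point there, the line through `y` orthogonal to `x
- y` supports `K`. In the direction of `x - y` the support functions therefore differ by at least
the distance. -/
theorem exists_infDist_le {C K : ConvexBody Plane} {x : Plane} (hx : x ∈ C) :
    ∃ θ, Metric.infDist x K ≤ |supportFun C θ - supportFun K θ| := by
  obtain ⟨y, hy, hxy⟩ := exists_norm_eq_iInf_of_complete_convex K.nonempty
    K.isCompact.isComplete K.convex x
  have hproj := (norm_eq_iInf_iff_real_inner_le_zero K.convex hy).1 hxy
  have hd : Metric.infDist x K ≤ ‖x - y‖ := by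
    rw [← dist_eq_norm]; exact Metric.infDist_le_dist_of_mem hy
  rcases (norm_nonneg (x - y)).eq_or_lt with h0 | hpos
  · exact ⟨0, hd.trans (h0 ▸ abs_nonneg _)⟩
  obtain ⟨θ, hθ⟩ := exists_eq_norm_smul_dir (x - y)
  refine ⟨θ, hd.trans (le_trans ?_ (le_abs_self _))⟩
  have h₁ : supportFun K θ ≤ inner ℝ y (dir θ) := supportFun_le K fun w hw => by
    have := hproj w hw
    rw [hθ, real_inner_smul_left] at this
    have := nonpos_of_mul_nonpos_right this hpos
    rw [real_inner_comm, inner_sub_left] at this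
    linarith
  have h₂ := inner_le_supportFun hx θ
  have h₃ : inner ℝ (x - y) (dir θ) = ‖x - y‖ := by
    conv_lhs => rw [hθ]
    rw [real_inner_smul_left, inner_dir_dir, sub_self, cos_zero, mul_one]
  rw [inner_sub_left] at h₃
  linarith

/-- The Hausdorff distance is the uniform distance of the support functions. -/
theorem exists_hausdorffDist_eq (C K : ConvexBody Plane) :
    ∃ θ, Metric.hausdorffDist (C : Set Plane) (K : Set Plane)
      = |supportFun C θ - supportFun K θ| := by
  obtain ⟨θ, hθ⟩ := exists_forall_le_of_periodic (f := fun t => |supportFun C t - supportFun K t|)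
    ((continuous_supportFun C).sub (continuous_supportFun K)).abs
    (fun t => by simp [periodic_supportFun C t, periodic_supportFun K t])
  refine ⟨θ, le_antisymm (Metric.hausdorffDist_le_of_infDist (abs_nonneg _) (fun x hx => ?_)
    fun x hx => ?_) (abs_supportFun_sub_le_hausdorffDist C K θ)⟩
  · obtain ⟨φ, hφ⟩ := exists_infDist_le (C := C) (K := K) hx
    exact hφ.trans (hθ φ)
  · obtain ⟨φ, hφ⟩ := exists_infDist_le (C := K) (K := C) hx
    rw [abs_sub_comm] at hφ
    exact hφ.trans (hθ φ)

/-! ### The extremal sets -/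

/-- The segment with endpoints `-v` and `v`. -/
def centeredSegment (v : Plane) : ConvexBody Plane where
  carrier := segment ℝ (-v) v
  convex' := convex_segment _ _
  isCompact' := by
    rw [segment_eq_image]
    exact isCompact_Icc.image (by fun_prop)
  nonempty' := ⟨v, right_mem_segment ℝ _ _⟩

/-- A point of contact in a direction of maximal support is the corresponding multiple of the
normal. -/
theorem eq_smul_dir_of_isMax {C : ConvexBody Plane} {θ : ℝ} {Q : Plane}
    (hmax : ∀ φ, supportFun C φ ≤ supportFun C θ) (hQ : IsSupportPoint C θ Q) :
    Q = supportFun C θ • dir θ := by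
  obtain ⟨φ, hφ⟩ := exists_eq_norm_smul_dir Q
  have h₁ : ‖Q‖ ≤ supportFun C θ := by
    refine le_trans (le_of_eq ?_) ((inner_le_supportFun hQ.1 φ).trans (hmax φ))
    conv_rhs => rw [hφ]
    rw [real_inner_smul_left, inner_dir_dir, sub_self, cos_zero, mul_one]
  have h₂ := hQ.2
  -- Equality in Cauchy–Schwarz: `‖Q‖ ≤ h θ = Q · e^{iθ}`, so `‖Q - h θ • e^{iθ}‖ ^ 2 = ‖Q‖ ^ 2 - (h
  -- θ) ^ 2 ≤ 0`.
  rw [← sub_eq_zero, ← norm_eq_zero, ← sq_eq_zero_iff]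
  refine le_antisymm ?_ (sq_nonneg _)
  rw [norm_sub_sq_real, norm_smul, norm_dir, real_inner_smul_right, h₂, mul_one, norm_eq_abs,
    sq_abs]
  nlinarith [norm_nonneg Q]

theorem hausdorffDist_le_supportFun_max {C K : ConvexBody Plane} (hC : C ∈ classA)
    (hK : K ∈ classA) {θ : ℝ} (hmax : ∀ φ, supportFun C φ ≤ supportFun C θ) :
    Metric.hausdorffDist (C : Set Plane) (K : Set Plane) ≤ supportFun C θ := by
  have HC := (mem_classA_iff C).1 hC
  have HK := (mem_classA_iff K).1 hK
  obtain ⟨φ, hφ⟩ := exists_hausdorffDist_eq C K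
  rw [hφ]
  refine abs_le'.2 ⟨?_, ?_⟩
  · linarith [HK.nonneg φ, hmax φ]
  · linarith [HK.le_pi_div_two φ, HC.pi_div_two_le φ, hmax (φ + π / 2), hmax (φ - π / 2)]

/-- Averaging over three directions gives `π/2 ≤ 2 max h_C`. Hence a maximal point `Q` is not `O`,
and orthogonality to `OQ` determines a direction. -/
theorem supportFun_max_pos {C : ConvexBody Plane} (hC : C ∈ classA) {θ : ℝ}
    (hmax : ∀ φ, supportFun C φ ≤ supportFun C θ) : 0 < supportFun C θ := by
  have HC := (mem_classA_iff C).1 hC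
  linarith [HC.pi_div_two_le θ, hmax (θ + π / 2), hmax (θ - π / 2), pi_pos]

theorem IsOrthogonalNeedle.mem_classA {Q : Plane} {K : ConvexBody Plane}
    (hK : IsOrthogonalNeedle Q K) : K ∈ classA := by
  obtain ⟨v, hv, -, hKv⟩ := hK
  exact mem_classA_of_eq_segment hv hKv

theorem supportFun_max_le_hausdorffDist {C K : ConvexBody Plane} (hC : C ∈ classA) {θ : ℝ}
    {Q : Plane} (hmax : ∀ φ, supportFun C φ ≤ supportFun C θ) (hQ : IsSupportPoint C θ Q)
    (hK : IsOrthogonalNeedle Q K) :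
    supportFun C θ ≤ Metric.hausdorffDist (C : Set Plane) (K : Set Plane) := by
  obtain ⟨v, -, hvQ, hKv⟩ := hK
  rw [eq_smul_dir_of_isMax hmax hQ, real_inner_smul_right] at hvQ
  have h0 : supportFun K θ = 0 := by
    rw [supportFun_of_eq_segment hKv,
      (mul_eq_zero.1 hvQ).resolve_left (supportFun_max_pos hC hmax).ne', abs_zero]
  have := supportFun_sub_le_hausdorffDist C K θ
  linarith

theorem isFarthest_of_isOrthogonalNeedle {C K : ConvexBody Plane} (hC : C ∈ classA) {Q : Plane}
    (hQ : IsMaxPoint C Q) (hK : IsOrthogonalNeedle Q K) : IsFarthest C K := by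
  obtain ⟨θ, hmax, hQθ⟩ := hQ
  exact ⟨hK.mem_classA, fun L hL => (hausdorffDist_le_supportFun_max hC hL hmax).trans
    (supportFun_max_le_hausdorffDist hC hmax hQθ hK)⟩

theorem isOrthogonalNeedle_of_supportFun_eq_zero {C K : ConvexBody Plane} (hK : K ∈ classA)
    {θ : ℝ} {Q : Plane} (hmax : ∀ φ, supportFun C φ ≤ supportFun C θ) (hQ : IsSupportPoint C θ Q)
    (h0 : supportFun K θ = 0) : IsOrthogonalNeedle Q K := by
  refine ⟨(π / 2) • dir (θ + π / 2), ?_, ?_, eq_segment_of_supportFun_eq_zero hK h0⟩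
  · rw [norm_smul, norm_dir, mul_one, norm_eq_abs, abs_of_pos (by positivity)]
  · rw [eq_smul_dir_of_isMax hmax hQ, real_inner_smul_left, real_inner_smul_right, inner_dir_dir,
      show θ + π / 2 - θ = π / 2 by ring, cos_pi_div_two]
    simp

theorem exists_isOrthogonalNeedle {C : ConvexBody Plane} :
    ∃ Q K, IsMaxPoint C Q ∧ IsOrthogonalNeedle Q K := by
  obtain ⟨θ, hmax⟩ := exists_forall_le_of_periodic (continuous_supportFun C)
    (periodic_supportFun C)
  obtain ⟨Q, hQ⟩ := exists_isSupportPoint C θ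
  refine ⟨Q, centeredSegment ((π / 2) • dir (θ + π / 2)), ⟨θ, hmax, hQ⟩, _, ?_, ?_, rfl⟩
  · rw [norm_smul, norm_dir, mul_one, norm_eq_abs, abs_of_pos (by positivity)]
  · rw [eq_smul_dir_of_isMax hmax hQ, real_inner_smul_left, real_inner_smul_right, inner_dir_dir,
      show θ + π / 2 - θ = π / 2 by ring, cos_pi_div_two]
    simp

theorem exists_supportFun_eq_zero_of_isFarthest {C K : ConvexBody Plane} (hC : C ∈ classA)
    (hK : IsFarthest C K) :
    ∃ θ, (∀ φ, supportFun C φ ≤ supportFun C θ) ∧ supportFun K θ = 0 := by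
  have HC := (mem_classA_iff C).1 hC
  have HK := (mem_classA_iff K).1 hK.1
  obtain ⟨Q, N, ⟨θ, hmax, hQ⟩, hN⟩ := exists_isOrthogonalNeedle (C := C)
  obtain ⟨φ, hφ⟩ := exists_hausdorffDist_eq C K
  have hd : supportFun C θ ≤ |supportFun C φ - supportFun K φ| := by
    rw [← hφ]
    exact (supportFun_max_le_hausdorffDist hC hmax hQ hN).trans (hK.2 N hN.mem_classA)
  -- If `h_C - h_K` reaches the maximum, then `φ` itself is a maximal direction of `h_C` with `h_K φ
  -- = 0`. If `h_K - h_C` does, then `h_K φ = π/2` and `h_C` is maximal at `φ ± π/2`, where the zero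
  -- width of `K` gives `h_K = 0`.
  rcases le_abs.1 hd with h | h
  · have h₁ := HK.nonneg φ
    have h₂ := hmax φ
    exact ⟨φ, fun ψ => by linarith [hmax ψ], by linarith⟩
  · have h₁ := HK.le_pi_div_two φ
    have h₂ := HC.pi_div_two_le φ
    have h₃ := hmax (φ + π / 2)
    have h₄ := hmax (φ - π / 2)
    exact ⟨φ + π / 2, fun ψ => by linarith [hmax ψ], HK.eq_zero_of_eq_pi_div_two (by linarith)⟩

end Plane

theorem mainTheorem3 (C : ConvexBody Plane) (hC : C ∈ Plane.classA) :
    (∃ K : ConvexBody Plane, Plane.IsFarthest C K) ∧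
      ∀ K : ConvexBody Plane, Plane.IsFarthest C K ↔
        ∃ Q : Plane, Plane.IsMaxPoint C Q ∧ Plane.IsOrthogonalNeedle Q K := by
  refine ⟨?_, fun K => ⟨fun hK => ?_, fun ⟨Q, hQ, hK⟩ =>
    Plane.isFarthest_of_isOrthogonalNeedle hC hQ hK⟩⟩
  · obtain ⟨Q, K, hQ, hK⟩ := Plane.exists_isOrthogonalNeedle (C := C)
    exact ⟨K, Plane.isFarthest_of_isOrthogonalNeedle hC hQ hK⟩
  · obtain ⟨θ, hmax, h0⟩ := Plane.exists_supportFun_eq_zero_of_isFarthest hC hK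
    obtain ⟨Q, hQ⟩ := Plane.exists_isSupportPoint C θ
    exact ⟨Q, ⟨θ, hmax, hQ⟩, Plane.isOrthogonalNeedle_of_supportFun_eq_zero hK.1 hmax hQ h0⟩
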